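/- **Theorem 1.3.** Equip the infinite torus $\mathbb{T}^\infty=\{(z_1,z_2,\ldots) : |z_n|=1\}$ with its normalized Haar measure. Let $H^2(\mathbb{T}^\infty)$ be the space of the functions in $L^2(\mathbb{T}^\infty)$ whose Fourier coefficients are supported on the finitely supported sequences of nonnegative integers, let $\overline{H^2}(\mathbb{T}^\infty)$ be the space of the complex conjugates of the functions in $H^2(\mathbb{T}^\infty)$, and let $P$ be the orthogonal projection from $L^2(\mathbb{T}^\infty)$ onto $H^2(\mathbb{T}^\infty)$. For $\varphi$ in $H^2(\mathbb{T}^\infty)$, the Hankel operator $\mathbf{H}_\varphi$ sends $f$ in $H^2(\mathbb{T}^\infty)$ to $\mathbf{H}_\varphi f=\overline{P}(\overline{\varphi}f)$ in $\overline{H^2}(\mathbb{T}^\infty)$, where $\overline{P}$ is the orthogonal projection from $L^2(\mathbb{T}^\infty)$ onto $\overline{H^2}(\mathbb{T}^\infty)$, understood through Fourier coefficients when $\overline{\varphi}f$ is only integrable: $\mathbf{H}_\varphi f$ is the element of $\overline{H^2}(\mathbb{T}^\infty)$ that has the Fourier coefficients of $\overline{\varphi}f$ at all frequencies without positive entries.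 Consider $$\varphi(z)=\frac{\sqrt6}{\pi}\sum_{k=1}^{\infty}\frac1k\prod_{j=(k-1)k/2+1}^{k(k+1)/2}\frac{z_{2j-1}+z_{2j}}{\sqrt2},$$ where the series converges in $L^2(\mathbb{T}^\infty)$. Then $\varphi\in H^2(\mathbb{T}^\infty)$, the operator $\mathbf{H}_\varphi\colon H^2(\mathbb{T}^\infty)\to\overline{H^2}(\mathbb{T}^\infty)$ is everywhere defined and bounded, and $$\|\mathbf{H}_\varphi\|=\|\varphi\|_{H^2(\mathbb{T}^\infty)}=1,$$ but for no $2<p\le\infty$ is there an element $\psi$ of $L^p(\mathbb{T}^\infty)$ such that $P\psi=\varphi$. -/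

import Mathlib

open MeasureTheory
open scoped ENNReal ComplexConjugate

noncomputable section

namespace InfTorus

/-- The normalized Haar measure of the infinite torus `𝕋^∞`: the product of countably many copies
of the normalized Haar measure of the circle. The circle is Mathlib's `UnitAddCircle = ℝ / ℤ`, a
point `t` of it standing for `exp (2 π i t)`, and `UnitAddTorus ℕ` is `ℕ → UnitAddCircle`. -/
def haar : Measure (UnitAddTorus ℕ) :=
  Measure.infinitePi fun _ : ℕ => (AddCircle.haarAddCircle : Measure UnitAddCircle)

instance : IsProbabilityMeasure haar := by
  unfold haar; infer_instance

/-- The Lebesgue space `L^p(𝕋^∞)`. -/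
abbrev L (p : ℝ≥0∞) : Type := Lp ℂ p haar

/-- The coordinate functions of `𝕋^∞`, numbered from zero: `z n` is the variable `z_{n+1}`. -/
def z (n : ℕ) (x : UnitAddTorus ℕ) : ℂ := fourier 1 (x n)

/-- The character `∏ₙ z_n ^ (α n)` of `𝕋^∞`, for a finitely supported family `α` of integers. -/
def character (α : ℕ →₀ ℤ) (x : UnitAddTorus ℕ) : ℂ := α.prod fun n a => fourier a (x n)

/-- The Fourier coefficient of `u` at the frequency `α`; meaningful for `u` in `L^1(𝕋^∞)`. -/
def coeff (u : UnitAddTorus ℕ → ℂ) (α : ℕ →₀ ℤ) : ℂ := ∫ x, conj (character α x) * u x ∂haar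

theorem continuous_character (α : ℕ →₀ ℤ) : Continuous (character α) := by
  unfold character Finsupp.prod
  fun_prop

theorem memLp_of_continuous {u : UnitAddTorus ℕ → ℂ} (hu : Continuous u) (p : ℝ≥0∞) :
    MemLp u p haar := by
  obtain ⟨C, hC⟩ := isCompact_univ.exists_bound_of_continuousOn hu.continuousOn
  exact MemLp.of_bound hu.aestronglyMeasurable C (.of_forall fun x => hC x (Set.mem_univ x))

/-- Fourier coefficients of square integrable functions are inner products. -/
theorem coeff_eq_inner (f : L 2) (α : ℕ →₀ ℤ) :
    coeff f α = inner ℂ ((memLp_of_continuous (continuous_character α) 2).toLp _) f := by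
  rw [L2.inner_def, coeff]
  refine integral_congr_ae ?_
  filter_upwards [(memLp_of_continuous (continuous_character α) 2).coeFn_toLp] with x hx
  rw [hx, RCLike.inner_apply, mul_comm]

/-- The Hardy space `H²(𝕋^∞)`: the functions in `L²(𝕋^∞)` whose Fourier coefficients are supported
on the frequencies with nonnegative entries. -/
def hardy : Submodule ℂ (L 2) where
  carrier := {f | ∀ α : ℕ →₀ ℤ, ¬ 0 ≤ α → coeff f α = 0}
  zero_mem' := fun α _ => by rw [coeff_eq_inner, inner_zero_right]
  add_mem' := fun {f g} hf hg α hα => by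
    have h1 := hf α hα
    have h2 := hg α hα
    rw [coeff_eq_inner] at h1 h2 ⊢
    rw [inner_add_right, h1, h2, add_zero]
  smul_mem' := fun c f hf α hα => by
    have h1 := hf α hα
    rw [coeff_eq_inner] at h1 ⊢
    rw [inner_smul_right, h1, mul_zero]

theorem isClosed_hardy : IsClosed (hardy : Set (L 2)) := by
  have h : (hardy : Set (L 2)) = ⋂ (α : ℕ →₀ ℤ) (_ : ¬ 0 ≤ α), {f : L 2 | inner ℂ
      ((memLp_of_continuous (continuous_character α) 2).toLp (character α)) f = (0 : ℂ)} := by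
    ext f
    simp only [Set.mem_iInter, Set.mem_ofPred_eq, ← coeff_eq_inner]
    rfl
  rw [h]
  exact isClosed_iInter fun α => isClosed_iInter fun _ =>
    isClosed_eq (by fun_prop) continuous_const

instance : CompleteSpace hardy := isClosed_hardy.completeSpace_coe

/-- The Riesz projection `P`: the orthogonal projection of `L²(𝕋^∞)` onto `H²(𝕋^∞)`. -/
def P : L 2 →L[ℂ] hardy := hardy.orthogonalProjectionOnto

/-- The space of the complex conjugates of the functions in `H²(𝕋^∞)`. -/
def conjHardy : Submodule ℂ (L 2) where
  carrier := {f | star f ∈ hardy}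
  zero_mem' := by
    have h : star (0 : L 2) = 0 := by
      refine Lp.ext ?_
      filter_upwards [Lp.coeFn_star (0 : L 2), Lp.coeFn_zero ℂ 2 haar] with x h1 h2
      rw [h1, Pi.star_apply, h2, Pi.zero_apply, star_zero]
    rw [Set.mem_ofPred_eq, h]
    exact hardy.zero_mem
  add_mem' := fun {f g} hf hg => by
    have h : star (f + g) = star f + star g := by
      refine Lp.ext ?_
      filter_upwards [Lp.coeFn_star (f + g), Lp.coeFn_star f, Lp.coeFn_star g, Lp.coeFn_add f g,
        Lp.coeFn_add (star f) (star g)] with x h1 h2 h3 h4 h5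
      rw [h1, Pi.star_apply, h4, h5, Pi.add_apply, Pi.add_apply, h2, h3, star_add]
      rfl
    rw [Set.mem_ofPred_eq, h]
    exact hardy.add_mem hf hg
  smul_mem' := fun c f hf => by
    have h : star (c • f) = conj c • star f := by
      refine Lp.ext ?_
      filter_upwards [Lp.coeFn_star (c • f), Lp.coeFn_star f, Lp.coeFn_smul c f,
        Lp.coeFn_smul (conj c) (star f)] with x h1 h2 h3 h4
      rw [h1, Pi.star_apply, h3, h4, Pi.smul_apply, Pi.smul_apply, h2, star_smul]
      rfl
    rw [Set.mem_ofPred_eq, h]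
    exact hardy.smul_mem _ hf

/-- `g` is the projection of the integrable function `u` to the conjugate Hardy space: `g` belongs
to that space and has the Fourier coefficients of `u` at the frequencies with nonpositive entries.
For square integrable `u` this is the orthogonal projection. -/
def IsConjProj (u : UnitAddTorus ℕ → ℂ) (g : conjHardy) : Prop :=
  ∀ α : ℕ →₀ ℤ, α ≤ 0 → coeff (g : L 2) α = coeff u α

/-- `H` is the (small) Hankel operator with symbol `φ`, as a bounded operator from `H²(𝕋^∞)` to the
conjugate Hardy space: `H f` is the projection of `conj φ * f` for every `f` in `H²(𝕋^∞)`. The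
product is in `L^1(𝕋^∞)` for all `f`, and such an `H` is unique if it exists. -/
def IsHankelOperator (φ : hardy) (H : hardy →L[ℂ] conjHardy) : Prop :=
  ∀ f : hardy, IsConjProj (fun x => conj ((φ : L 2) x) * (f : L 2) x) (H f)

/-- The inclusion of `L^p(𝕋^∞)` in `L²(𝕋^∞)` for `2 ≤ p ≤ ∞`. -/
def toL2 {p : ℝ≥0∞} (hp : 2 ≤ p) (ψ : L p) : L 2 := ((Lp.memLp ψ).mono_exponent hp).toLp ψ

/-- For `k ≥ 1`, the product of `(z_{2j-1} + z_{2j}) / √2` over the `k` integers `j` with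
`(k-1)k/2 + 1 ≤ j ≤ k(k+1)/2`; here `i` is `j - 1`, and variables are numbered from zero. -/
def block (k : ℕ) (x : UnitAddTorus ℕ) : ℂ :=
  ∏ i ∈ Finset.Ico ((k - 1) * k / 2) (k * (k + 1) / 2),
    (z (2 * i) x + z (2 * i + 1) x) / (Real.sqrt 2 : ℂ)

theorem continuous_block (k : ℕ) : Continuous (block k) := by
  unfold block z
  fun_prop

/-- The function `block k` as an element of `L²(𝕋^∞)`. -/
def blockL2 (k : ℕ) : L 2 := (memLp_of_continuous (continuous_block k) 2).toLp (block k)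

/-- The symbol `φ = (√6 / π) ∑_{k ≥ 1} φ_k / k`, a series that converges in `L²(𝕋^∞)`, where
`φ_k` is `block k` (and `k` is written `n + 1`). -/
def IsSymbol (φ : hardy) : Prop :=
  HasSum (fun n : ℕ => ((Real.sqrt 6 / Real.pi * (1 / ((n : ℝ) + 1)) : ℝ) : ℂ) • blockL2 (n + 1))
    (φ : L 2)

end InfTorus

end

/-! The block of index `n + 1` is a product of `n + 1` factors in disjoint pairs of variables. Its
expansion has `2 ^ (n + 1)` monomials, one for each transversal `S` (one variable from every pair),
all with coefficient `(1/√2) ^ (n + 1)`. Different blocks use disjoint variables, so the blocks are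
orthonormal, and the Basel sum gives `‖φ‖ = 1`.

Boundedness. Let `m S` be the Fourier coefficient of `φ` at the indicator of `S`. Only indicators
occur in `φ`, so for `f` in the Hardy space only indicator frequencies of `f` matter, and the output
lives on negatives of indicators. The matrix of the Hankel operator therefore has entry `m (A ∪ B)`
for disjoint finite sets `A`, `B`, and zero otherwise. The Schur test is applied with the weight `w
A = m A` when `A` is a transversal and `w A = (1/√2) ^ |A|` otherwise, for which every row sum is at
most `w A`. For empty `A` this is `∑ m S ^ 2 = 1 = w ∅`. For a transversal only `S = A` contributes.
For a nonempty proper part of a transversal of block `n + 1` there are at most `2 ^ (n + 1 - |A|)`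
sets `S ⊇ A`, and the powers of two cancel (`weight_row_le`, `tsum_sq_mass_le`). Hence the norm is
at most one, and applying the operator to the constant `1` shows that it is at least one.

No preimage in `L^p`. If `P ψ = φ`, pairing with a block gives the amplitude `√6 / (π (n + 1))`. By
Hölder this is at most `‖ψ‖_p` times the `L^q` norm of the block, with `q < 2` the conjugate
exponent. By independence that norm is `θ ^ (n + 1)`, where `θ` is the `L^q` norm of `(z₁ + z₂)/√2`.
This function has `L²` norm one and nonconstant modulus, so `θ < 1`, and exponential decay
contradicts decay of order `1/n`. -/

noncomputable section

namespace InfTorus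

/-! ### Weighted Cauchy-Schwarz and the Schur test -/

/-- The Cauchy-Schwarz inequality for sums with a weight. -/
theorem sq_tsum_mul_le {ι : Type*} (k f w : ι → ℝ≥0∞) (hw : ∀ i, w i ≠ 0)
    (hw' : ∀ i, w i ≠ ∞) :
    (∑' i, k i * f i) ^ 2 ≤ (∑' i, k i * w i) * ∑' i, k i * (f i ^ 2 / w i) := by
  -- Sums are integrals against counting measure, so this is Hölder with exponents two for the
  -- splitting of `k f` into `√(k w)` and `√(k f² / w)`.
  let : MeasurableSpace ι := ⊤
  have h := ENNReal.lintegral_mul_le_Lp_mul_Lq (Measure.count : Measure ι)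
    Real.HolderConjugate.two_two (f := fun i => (k i * w i) ^ (1 / 2 : ℝ))
    (g := fun i => (k i * (f i ^ 2 / w i)) ^ (1 / 2 : ℝ))
    (measurable_from_top.aemeasurable) (measurable_from_top.aemeasurable)
  simp only [lintegral_count, Pi.mul_apply, ← ENNReal.rpow_mul] at h
  have e : ∀ i, (k i * w i) ^ (1 / 2 : ℝ) * (k i * (f i ^ 2 / w i)) ^ (1 / 2 : ℝ) = k i * f i := by
    intro i
    rw [← ENNReal.mul_rpow_of_nonneg _ _ (by norm_num)]
    have : k i * w i * (k i * (f i ^ 2 / w i)) = (k i * f i) ^ (2 : ℝ) := by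
      rw [ENNReal.rpow_two, mul_pow, sq (k i)]
      calc _ = k i * k i * (w i * (f i ^ 2 / w i)) := by ring
        _ = _ := by rw [ENNReal.mul_div_cancel (hw i) (hw' i)]
    rw [this, ← ENNReal.rpow_mul]
    norm_num
  simp only [e] at h
  norm_num at h
  calc _ ≤ ((∑' i, k i * w i) ^ (1 / 2 : ℝ) * (∑' i, k i * (f i ^ 2 / w i)) ^ (1 / 2 : ℝ)) ^ 2 := by
        gcongr
    _ = _ := by
        rw [← ENNReal.mul_rpow_of_nonneg _ _ (by norm_num), ← ENNReal.rpow_two,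
          ← ENNReal.rpow_mul]
        norm_num

/-- The Schur test for the kernel `(A, B) ↦ m (A ∪ B)`, restricted to disjoint finite sets. -/
theorem schur_test (m w f : Finset ℕ → ℝ≥0∞) (hw : ∀ A, w A ≠ 0) (hw' : ∀ A, w A ≠ ∞)
    (row : ∀ A, ∑' S, m S * (if A ⊆ S then w (S \ A) else 0) ≤ w A) :
    ∑' B, (∑' S, m S * (if B ⊆ S then f (S \ B) else 0)) ^ 2 ≤ ∑' A, f A ^ 2 := by
  -- Cauchy-Schwarz with weight `w (S \ B)`; the first factor is then the row sum at `B`.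
  have h1 : ∀ B, (∑' S, m S * (if B ⊆ S then f (S \ B) else 0)) ^ 2 ≤
      ∑' S, m S * (if B ⊆ S then w B * (f (S \ B) ^ 2 / w (S \ B)) else 0) := by
    intro B
    have := sq_tsum_mul_le (fun S => m S * if B ⊆ S then 1 else 0) (fun S => f (S \ B))
      (fun S => w (S \ B)) (fun S => hw _) (fun S => hw' _)
    simp only [mul_assoc, ite_mul, one_mul, zero_mul] at this
    refine this.trans ((mul_le_mul_left (row B) _).trans ?_)
    rw [← ENNReal.tsum_mul_left]
    refine ENNReal.tsum_le_tsum fun S => ?_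
    split_ifs
    · exact le_of_eq (by ring)
    · simp
  refine (ENNReal.tsum_le_tsum h1).trans ?_
  -- Complementation in `S` is an involution of its subsets and exchanges `B` with `A = S \ B`. The
  -- symmetry of the kernel lets the row bound serve for columns too.
  have h2 : ∀ S : Finset ℕ,
      (∑' B, m S * (if B ⊆ S then w B * (f (S \ B) ^ 2 / w (S \ B)) else 0)) =
      ∑' A, m S * (if A ⊆ S then w (S \ A) * (f A ^ 2 / w A) else 0) := by
    intro S
    have key : ∀ g : Finset ℕ → ℝ≥0∞, ∑' B, (if B ⊆ S then g B else 0) = ∑ B ∈ S.powerset, g B := by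
      intro g
      rw [tsum_eq_sum (s := S.powerset)]
      · exact Finset.sum_congr rfl fun B hB => if_pos (Finset.mem_powerset.1 hB)
      · intro B hB
        exact if_neg fun h => hB (Finset.mem_powerset.2 h)
    rw [ENNReal.tsum_mul_left, ENNReal.tsum_mul_left,
      key (fun B => w B * (f (S \ B) ^ 2 / w (S \ B))), key (fun A => w (S \ A) * (f A ^ 2 / w A))]
    congr 1
    refine Finset.sum_nbij' (S \ ·) (S \ ·) ?_ ?_ ?_ ?_ ?_
    · simp
    · simp
    · intro A hA; simpa using hA
    · intro A hA; simpa using hA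
    · intro A hA
      simp [Finset.sdiff_sdiff_eq_self (Finset.mem_powerset.1 hA)]
  rw [ENNReal.tsum_comm]
  simp only [h2]
  rw [ENNReal.tsum_comm]
  refine ENNReal.tsum_le_tsum fun A => ?_
  calc ∑' S, m S * (if A ⊆ S then w (S \ A) * (f A ^ 2 / w A) else 0)
      = (∑' S, m S * (if A ⊆ S then w (S \ A) else 0)) * (f A ^ 2 / w A) := by
        rw [← ENNReal.tsum_mul_right]
        refine tsum_congr fun S => ?_
        split_ifs <;> ring
    _ ≤ w A * (f A ^ 2 / w A) := mul_le_mul_left (row A) _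
    _ = f A ^ 2 := ENNReal.mul_div_cancel (hw A) (hw' A)

/-! ### Combinatorics of the transversals -/

/-- The indices of the factors of `block k`. -/
def blockIndices (k : ℕ) : Finset ℕ := Finset.Ico ((k - 1) * k / 2) (k * (k + 1) / 2)

/-- The set of variables obtained by choosing `2 i` for `i` in `t` and `2 i + 1` for the other `i`
in `s`. -/
def choice (s t : Finset ℕ) : Finset ℕ := t.image (2 * ·) ∪ (s \ t).image (2 * · + 1)

/-- The supports of the frequencies of `block k`. -/
def transversals (k : ℕ) : Finset (Finset ℕ) :=
  (blockIndices k).powerset.image (choice (blockIndices k))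

theorem card_blockIndices (n : ℕ) : (blockIndices (n + 1)).card = n + 1 := by
  rw [blockIndices, Nat.card_Ico, Nat.add_sub_cancel]
  have h : (n + 1) * (n + 1 + 1) = n * (n + 1) + (n + 1) * 2 := by ring
  rw [h, Nat.add_mul_div_right _ _ two_pos]
  omega

/-- The index intervals run between consecutive triangular numbers, hence are disjoint. -/
theorem eq_of_mem_blockIndices {i n m : ℕ} (hn : i ∈ blockIndices (n + 1))
    (hm : i ∈ blockIndices (m + 1)) : n = m := by
  have key : ∀ {n m : ℕ}, i ∈ blockIndices (n + 1) → i ∈ blockIndices (m + 1) → ¬ n < m := by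
    intro n m hn hm h
    rw [blockIndices, Finset.mem_Ico, Nat.add_sub_cancel] at hn hm
    have : (n + 1) * (n + 1 + 1) / 2 ≤ m * (m + 1) / 2 :=
      Nat.div_le_div_right (Nat.mul_le_mul (by omega) (by omega))
    omega
  have := key hn hm
  have := key hm hn
  omega

theorem even_mem_choice {s t : Finset ℕ} {i : ℕ} : 2 * i ∈ choice s t ↔ i ∈ t := by
  simp only [choice, Finset.mem_union, Finset.mem_image]
  constructor
  · rintro (⟨j, hj, h⟩ | ⟨j, hj, h⟩)
    · obtain rfl : j = i := by omega
      exact hj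
    · omega
  · exact fun h => Or.inl ⟨i, h, rfl⟩

theorem odd_mem_choice {s t : Finset ℕ} {i : ℕ} : 2 * i + 1 ∈ choice s t ↔ i ∈ s ∧ i ∉ t := by
  simp only [choice, Finset.mem_union, Finset.mem_image, Finset.mem_sdiff]
  constructor
  · rintro (⟨j, hj, h⟩ | ⟨j, hj, h⟩)
    · omega
    · obtain rfl : j = i := by omega
      exact hj
  · exact fun h => Or.inr ⟨i, h, rfl⟩

theorem choice_injective (s : Finset ℕ) : Function.Injective (choice s) := by
  intro t t' h
  ext i
  rw [← even_mem_choice (s := s), h, even_mem_choice]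

theorem disjoint_images (s t : Finset ℕ) :
    Disjoint (t.image (2 * ·)) ((s \ t).image (2 * · + 1)) := by
  rw [Finset.disjoint_left]
  intro x hx hy
  obtain ⟨i, -, rfl⟩ := Finset.mem_image.1 hx
  obtain ⟨j, -, h⟩ := Finset.mem_image.1 hy
  omega

theorem card_choice {s t : Finset ℕ} (h : t ⊆ s) : (choice s t).card = s.card := by
  rw [choice, Finset.card_union_of_disjoint (disjoint_images s t),
    Finset.card_image_of_injective _ (fun a b h => by simpa using h),
    Finset.card_image_of_injective _ (fun a b h => by simpa using h),
    add_comm, Finset.card_sdiff_add_card_eq_card h]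

theorem half_mem_of_mem_choice {s t : Finset ℕ} (h : t ⊆ s) {j : ℕ} (hj : j ∈ choice s t) :
    j / 2 ∈ s := by
  obtain ⟨i, rfl | rfl⟩ := Nat.even_or_odd' j
  · simpa using h (even_mem_choice.1 hj)
  · have : (2 * i + 1) / 2 = i := by omega
    rw [this]
    exact (odd_mem_choice.1 hj).1

/-- Each element of `A` dictates the choice in its pair. The admissible sets `t` form an interval of
the Boolean lattice: they contain `A₀`, where the even variable is forced, and avoid `A₁`, where the
odd one is. Thus `|A|` binary choices are lost. -/
theorem card_filter_transversals (n : ℕ) (A : Finset ℕ) :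
    ((transversals n).filter (A ⊆ ·)).card * 2 ^ A.card ≤ 2 ^ (blockIndices n).card := by
  set s := blockIndices n with hs
  set A₀ := s.filter (2 * · ∈ A) with hA₀
  set A₁ := s.filter (2 * · + 1 ∈ A) with hA₁
  rcases ((transversals n).filter (A ⊆ ·)).eq_empty_or_nonempty with h | ⟨S, hS⟩
  · simp [h]
  have hsub : ∀ t ⊆ s, A ⊆ choice s t → A₀ ⊆ t ∧ t ⊆ s \ A₁ := by
    intro t ht hA
    refine ⟨fun i hi => ?_, fun i hi => ?_⟩
    · exact even_mem_choice.1 (hA (Finset.mem_filter.1 hi).2)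
    · refine Finset.mem_sdiff.2 ⟨ht hi, fun h => ?_⟩
      exact (odd_mem_choice.1 (hA (Finset.mem_filter.1 h).2)).2 hi
  rw [Finset.mem_filter, transversals, Finset.mem_image] at hS
  obtain ⟨⟨t, ht, rfl⟩, hA⟩ := hS
  rw [Finset.mem_powerset] at ht
  have hcardA : A.card ≤ A₀.card + A₁.card := by
    refine (Finset.card_le_card (t := A₀.image (2 * ·) ∪ A₁.image (2 * · + 1)) ?_).trans
      ((Finset.card_union_le _ _).trans (add_le_add Finset.card_image_le Finset.card_image_le))
    intro j hj
    have hjs := half_mem_of_mem_choice ht (hA hj)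
    obtain ⟨i, rfl | rfl⟩ := Nat.even_or_odd' j
    · refine Finset.mem_union_left _ (Finset.mem_image.2 ⟨i, ?_, rfl⟩)
      exact Finset.mem_filter.2 ⟨by simpa using hjs, hj⟩
    · refine Finset.mem_union_right _ (Finset.mem_image.2 ⟨i, ?_, rfl⟩)
      have h2 : (2 * i + 1) / 2 = i := by omega
      exact Finset.mem_filter.2 ⟨by simpa [h2] using hjs, hj⟩
  have hle : ((transversals n).filter (A ⊆ ·)).card ≤ (Finset.Icc A₀ (s \ A₁)).card := by
    refine (Finset.card_le_card (t := (Finset.Icc A₀ (s \ A₁)).image (choice s)) ?_).trans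
      Finset.card_image_le
    intro S hS
    rw [Finset.mem_filter, transversals, Finset.mem_image] at hS
    obtain ⟨⟨t, ht, rfl⟩, hA⟩ := hS
    exact Finset.mem_image.2 ⟨t, Finset.mem_Icc.2 (hsub t (Finset.mem_powerset.1 ht) hA), rfl⟩
  have h0 := hsub t ht hA
  have h01 := h0.1.trans h0.2
  rw [Finset.card_Icc_finset h01] at hle
  have hc1 : (s \ A₁).card + A₁.card = s.card :=
    Finset.card_sdiff_add_card_eq_card (Finset.filter_subset _ _)
  have hc2 := Finset.card_le_card h01
  calc _ ≤ 2 ^ ((s \ A₁).card - A₀.card) * 2 ^ (A₀.card + A₁.card) :=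
        Nat.mul_le_mul hle (Nat.pow_le_pow_right two_pos hcardA)
    _ = 2 ^ s.card := by rw [← pow_add]; congr 1; omega

theorem card_transversals (n : ℕ) : (transversals n).card = 2 ^ (blockIndices n).card := by
  rw [transversals, Finset.card_image_of_injective _ (choice_injective _), Finset.card_powerset]

theorem card_of_mem_transversals {n : ℕ} {S : Finset ℕ} (h : S ∈ transversals (n + 1)) :
    S.card = n + 1 := by
  obtain ⟨t, ht, rfl⟩ := Finset.mem_image.1 h
  rw [card_choice (Finset.mem_powerset.1 ht), card_blockIndices]

/-- A variable `j` determines its pair `j / 2`, and the pair determines the block. -/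
theorem eq_of_mem_transversals {n m : ℕ} {S T : Finset ℕ} (hS : S ∈ transversals (n + 1))
    (hT : T ∈ transversals (m + 1)) {j : ℕ} (hjS : j ∈ S) (hjT : j ∈ T) : n = m := by
  obtain ⟨t, ht, rfl⟩ := Finset.mem_image.1 hS
  obtain ⟨t', ht', rfl⟩ := Finset.mem_image.1 hT
  exact eq_of_mem_blockIndices (half_mem_of_mem_choice (Finset.mem_powerset.1 ht) hjS)
    (half_mem_of_mem_choice (Finset.mem_powerset.1 ht') hjT)

theorem nonempty_of_mem_transversals {n : ℕ} {S : Finset ℕ} (h : S ∈ transversals (n + 1)) :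
    S.Nonempty := by
  rw [← Finset.card_pos, card_of_mem_transversals h]
  exact n.succ_pos

theorem index_unique {n m : ℕ} {S : Finset ℕ} (hS : S ∈ transversals (n + 1))
    (hT : S ∈ transversals (m + 1)) : n = m := by
  obtain ⟨j, hj⟩ := nonempty_of_mem_transversals hS
  exact eq_of_mem_transversals hS hT hj hj

/-- Members of the families of transversals are incomparable. -/
theorem eq_of_subset_of_mem_transversals {n m : ℕ} {S T : Finset ℕ}
    (hS : S ∈ transversals (n + 1)) (hT : T ∈ transversals (m + 1)) (h : S ⊆ T) : S = T := by
  obtain ⟨j, hj⟩ := nonempty_of_mem_transversals hS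
  obtain rfl := eq_of_mem_transversals hS hT hj (h hj)
  exact Finset.eq_of_subset_of_card_le h
    (by rw [card_of_mem_transversals hS, card_of_mem_transversals hT])

/-! ### Coefficients, weights and the row estimate -/

/-- The Fourier coefficient at the indicator of `S` of the series `∑ c n • block (n + 1)`, when `r`
is `1 / √2`. -/
def mass (c : ℕ → ℝ≥0∞) (r : ℝ≥0∞) (S : Finset ℕ) : ℝ≥0∞ :=
  ∑' n, if S ∈ transversals (n + 1) then c n * r ^ (n + 1) else 0

/-- The weight in the Schur test. -/
def weight (c : ℕ → ℝ≥0∞) (r : ℝ≥0∞) (S : Finset ℕ) : ℝ≥0∞ :=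
  if mass c r S = 0 then r ^ S.card else mass c r S

section

variable {c : ℕ → ℝ≥0∞} {r : ℝ≥0∞}

theorem mass_of_mem {n : ℕ} {S : Finset ℕ} (h : S ∈ transversals (n + 1)) :
    mass c r S = c n * r ^ (n + 1) := by
  rw [mass, tsum_eq_single n, if_pos h]
  exact fun m hm => if_neg fun h' => hm (index_unique h' h)

theorem mass_of_forall_notMem {S : Finset ℕ} (h : ∀ n, S ∉ transversals (n + 1)) :
    mass c r S = 0 := by
  simp [mass, h]

theorem tsum_mass_mul (g : Finset ℕ → ℝ≥0∞) :
    ∑' S, mass c r S * g S = ∑' n, c n * r ^ (n + 1) * ∑ S ∈ transversals (n + 1), g S := by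
  simp only [mass, ← ENNReal.tsum_mul_right]
  rw [ENNReal.tsum_comm]
  refine tsum_congr fun n => ?_
  rw [tsum_eq_sum (s := transversals (n + 1)), Finset.mul_sum]
  · exact Finset.sum_congr rfl fun S hS => by rw [if_pos hS]
  · intro S hS
    rw [if_neg hS, zero_mul]

/-- Block `n + 1` contributes `2 ^ (n + 1)` equal squares `c n ^ 2 * 2 ^ (-(n + 1))`, that is, `c n
^ 2`. -/
theorem tsum_mass_sq (hr : r ^ 2 * 2 = 1) (hc : ∑' n, c n ^ 2 = 1) :
    ∑' S, mass c r S ^ 2 = 1 := by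
  simp only [sq (mass c r _)]
  rw [tsum_mass_mul, ← hc]
  refine tsum_congr fun n => ?_
  rw [Finset.sum_congr rfl fun S hS => mass_of_mem hS, Finset.sum_const, card_transversals,
    card_blockIndices, nsmul_eq_mul]
  push_cast
  calc _ = c n ^ 2 * (r ^ 2 * 2) ^ (n + 1) := by ring
    _ = c n ^ 2 := by rw [hr]; simp

theorem weight_ne_zero (hr : r ≠ 0) (S : Finset ℕ) : weight c r S ≠ 0 := by
  unfold weight
  split_ifs with h
  · exact pow_ne_zero _ hr
  · exact h

theorem weight_ne_top (hr : r ≠ ∞) (hc : ∀ n, c n ≠ ∞) (S : Finset ℕ) : weight c r S ≠ ∞ := by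
  unfold weight
  split_ifs with h
  · exact ENNReal.pow_ne_top hr
  · by_cases h' : ∃ n, S ∈ transversals (n + 1)
    · obtain ⟨n, hn⟩ := h'
      rw [mass_of_mem hn]
      exact ENNReal.mul_ne_top (hc n) (ENNReal.pow_ne_top hr)
    · rw [mass_of_forall_notMem (not_exists.1 h')]
      exact ENNReal.zero_ne_top

theorem weight_row_le (hr : r ^ 2 * 2 = 1) (hc0 : ∀ n, c n ≠ 0) (hc1 : ∀ n, c n ≤ 1)
    (hc : ∑' n, c n ^ 2 = 1) (A : Finset ℕ) :
    ∑' S, mass c r S * (if A ⊆ S then weight c r (S \ A) else 0) ≤ weight c r A := by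
  have hr0 : r ≠ 0 := by rintro rfl; simp at hr
  have hm0 : ∀ {n : ℕ} {S}, S ∈ transversals (n + 1) → mass c r S ≠ 0 := fun {n S} h => by
    rw [mass_of_mem h]
    exact mul_ne_zero (hc0 n) (pow_ne_zero _ hr0)
  have hempty : mass c r ∅ = 0 := mass_of_forall_notMem fun n h => by
    simpa using nonempty_of_mem_transversals h
  have hw0 : weight c r ∅ = 1 := by simp [weight, hempty]
  rcases A.eq_empty_or_nonempty with rfl | hA
  -- For empty `A` the row sum is the sum of `mass ^ 2`, because the weight equals the mass wherever
  -- the mass is nonzero.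
  · rw [hw0, ← tsum_mass_sq (c := c) hr hc]
    refine ENNReal.tsum_le_tsum fun S => ?_
    simp only [Finset.empty_subset, if_true, Finset.sdiff_empty, sq]
    by_cases h : mass c r S = 0
    · simp [h]
    · simp [weight, h]
  by_cases hmem : ∃ n, A ∈ transversals (n + 1)
  -- Transversals are incomparable, so the only term is `S = A`, of value `mass A * weight ∅ = mass
  -- A`.
  · obtain ⟨n, hn⟩ := hmem
    rw [tsum_eq_single A]
    · rw [if_pos subset_rfl, Finset.sdiff_self, hw0, mul_one, weight, if_neg (hm0 hn)]
    · intro S hS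
      split_ifs with hAS
      · rw [mass_of_forall_notMem, zero_mul]
        exact fun m hm => hS (eq_of_subset_of_mem_transversals hn hm hAS).symm
      · rw [mul_zero]
  push Not at hmem
  have hwA : weight c r A = r ^ A.card := by simp [weight, mass_of_forall_notMem hmem]
  rw [hwA]
  by_cases hex : ∃ n, ∃ S ∈ transversals (n + 1), A ⊆ S
  swap
  · push Not at hex
    rw [ENNReal.tsum_eq_zero.2]
    · exact zero_le
    · intro S
      split_ifs with hAS
      · rw [mass_of_forall_notMem fun n hn => hex n S hn hAS, zero_mul]
      · rw [mul_zero]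
  obtain ⟨n, S₀, hS₀, hAS₀⟩ := hex
  obtain ⟨j, hj⟩ := hA
  have hcard : A.card ≤ n + 1 := by
    rw [← card_of_mem_transversals hS₀]
    exact Finset.card_le_card hAS₀
  -- Since `A` is nonempty, a single one of its elements pins down the block.
  rw [tsum_mass_mul, tsum_eq_single n]
  swap
  · intro m hm
    rw [Finset.sum_eq_zero, mul_zero]
    intro S hS
    refine if_neg fun hAS => hm ?_
    exact eq_of_mem_transversals hS hS₀ (hAS hj) (hAS₀ hj)
  have hsum : ∀ S ∈ transversals (n + 1), (if A ⊆ S then weight c r (S \ A) else 0) =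
      if A ⊆ S then r ^ (n + 1 - A.card) else 0 := by
    intro S hS
    split_ifs with hAS
    -- A transversal inside `S` would be `S` itself, but `S \ A` misses `j`. So the weight of `S \
    -- A` is the power of `r`.
    · have hd : ∀ m, S \ A ∉ transversals (m + 1) := by
        intro m hm
        have := eq_of_subset_of_mem_transversals hm hS Finset.sdiff_subset
        rw [Finset.sdiff_eq_self_iff_disjoint, Finset.disjoint_left] at this
        exact this (hAS hj) hj
      simp [weight, mass_of_forall_notMem hd, Finset.card_sdiff_of_subset hAS,
        card_of_mem_transversals hS]
    · rfl
  rw [Finset.sum_congr rfl hsum, ← Finset.sum_filter, Finset.sum_const, nsmul_eq_mul]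
  have hcount := card_filter_transversals (n + 1) A
  rw [card_blockIndices] at hcount
  set N := ((transversals (n + 1)).filter (A ⊆ ·)).card
  -- Here `d` counts the pairs not touched by `A`; the `2 ^ d` extensions cancel against `r ^ (2
  -- d)`.
  obtain ⟨d, hd⟩ := Nat.exists_eq_add_of_le hcard
  have hN : (N : ℝ≥0∞) ≤ 2 ^ d := by
    have : N ≤ 2 ^ d := by
      rw [hd, pow_add, mul_comm (2 ^ A.card)] at hcount
      exact Nat.le_of_mul_le_mul_right hcount (by positivity)
    exact_mod_cast this
  rw [hd, Nat.add_sub_cancel_left]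
  calc c n * r ^ (A.card + d) * (N * r ^ d) ≤ 1 * r ^ (A.card + d) * (2 ^ d * r ^ d) := by
        gcongr
        exact hc1 n
    _ = r ^ A.card * (r ^ 2 * 2) ^ d := by ring
    _ = r ^ A.card := by rw [hr]; simp

theorem tsum_sq_mass_le (hr : r ^ 2 * 2 = 1) (hc0 : ∀ n, c n ≠ 0) (hc1 : ∀ n, c n ≤ 1)
    (hc : ∑' n, c n ^ 2 = 1) (f : Finset ℕ → ℝ≥0∞) :
    ∑' B, (∑' S, mass c r S * (if B ⊆ S then f (S \ B) else 0)) ^ 2 ≤ ∑' A, f A ^ 2 := by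
  refine schur_test _ (weight c r) f (weight_ne_zero ?_) (weight_ne_top ?_ ?_)
    (weight_row_le hr hc0 hc1 hc)
  · rintro rfl; simp at hr
  · rintro rfl; simp at hr
  · exact fun n => ne_top_of_le_ne_top ENNReal.one_ne_top (hc1 n)

end

/-! ### Characters and their orthonormality -/

theorem character_zero (x : UnitAddTorus ℕ) : character 0 x = 1 := by
  simp [character]

theorem character_add (α β : ℕ →₀ ℤ) (x : UnitAddTorus ℕ) :
    character (α + β) x = character α x * character β x := by
  unfold character
  exact Finsupp.prod_add_index' (fun n => fourier_zero) (fun n a b => fourier_add)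

theorem character_neg (α : ℕ →₀ ℤ) (x : UnitAddTorus ℕ) :
    character (-α) x = conj (character α x) := by
  unfold character
  rw [Finsupp.prod_neg_index (h := fun n a => fourier a (x n)) (fun n => fourier_zero),
    Finsupp.prod, Finsupp.prod, map_prod]
  exact Finset.prod_congr rfl fun n _ => fourier_neg

theorem norm_character (α : ℕ →₀ ℤ) (x : UnitAddTorus ℕ) : ‖character α x‖ = 1 := by
  have h : character α x * conj (character α x) = 1 := by
    rw [← character_neg, ← character_add, add_neg_cancel, character_zero]
  rw [Complex.mul_conj, ← Complex.ofReal_one, Complex.ofReal_inj, Complex.normSq_eq_norm_sq] at h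
  exact (pow_eq_one_iff_of_nonneg (norm_nonneg _) two_ne_zero).1 h

theorem integral_fourier (n : ℤ) :
    ∫ t : UnitAddCircle, fourier n t ∂AddCircle.haarAddCircle = if n = 0 then 1 else 0 := by
  have h := congrFun (fourierCoeff_fourier (T := 1) n) 0
  simp only [fourierCoeff, neg_zero, fourier_zero, one_smul] at h
  rw [h, Pi.single_apply]
  simp [eq_comm]

theorem iIndepFun_eval : ProbabilityTheory.iIndepFun
    (fun (i : ℕ) (x : UnitAddTorus ℕ) => x i) haar :=
  ProbabilityTheory.iIndepFun_infinitePi (X := fun _ t => t) (fun _ => measurable_id)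

theorem measurePreserving_eval (i : ℕ) :
    MeasurePreserving (fun x : UnitAddTorus ℕ => x i) haar AddCircle.haarAddCircle :=
  measurePreserving_eval_infinitePi (fun _ : ℕ => (AddCircle.haarAddCircle : Measure UnitAddCircle)) i

/-- The coordinates are independent, so the integral factors, and one nonzero exponent makes a
factor vanish. -/
theorem integral_character (α : ℕ →₀ ℤ) :
    ∫ x, character α x ∂haar = if α = 0 then 1 else 0 := by
  have h1 : ∀ x, character α x = ∏ i : α.support, fourier (α i) (x i) := fun x => by
    rw [character, Finsupp.prod, ← Finset.prod_coe_sort]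
  simp only [h1]
  have hind := iIndepFun_eval.precomp (g := fun i : α.support => (i : ℕ))
    Subtype.val_injective
  rw [hind.integral_fun_prod_comp (f := fun (i : α.support) (t : UnitAddCircle) => fourier (α i) t)
    (fun i => (measurable_pi_apply _).aemeasurable)
    (fun i => (fourier (α i)).continuous.aestronglyMeasurable)]
  have h2 : ∀ i : ℕ, ∫ x, fourier (α i) (x i) ∂haar = if α i = 0 then (1 : ℂ) else 0 := fun i => by
    rw [← integral_fourier, ← (measurePreserving_eval i).map_eq, integral_map]
    · exact (measurable_pi_apply i).aemeasurable
    · exact (fourier (α i)).continuous.aestronglyMeasurable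
  split_ifs with h
  · subst h
    simp
  · obtain ⟨n, hn⟩ := Finsupp.ne_iff.1 h
    refine Finset.prod_eq_zero (Finset.mem_univ ⟨n, Finsupp.mem_support_iff.2 hn⟩) ?_
    rw [h2]
    exact if_neg hn

/-- The character of frequency `α` as an element of `L²`. -/
def chi (α : ℕ →₀ ℤ) : L 2 := (memLp_of_continuous (continuous_character α) 2).toLp (character α)

theorem coeFn_chi (α : ℕ →₀ ℤ) : chi α =ᵐ[haar] character α :=
  (memLp_of_continuous (continuous_character α) 2).coeFn_toLp

theorem coeff_eq_inner_chi (f : L 2) (α : ℕ →₀ ℤ) : coeff f α = inner ℂ (chi α) f :=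
  coeff_eq_inner f α

theorem coeff_congr {u v : UnitAddTorus ℕ → ℂ} (h : u =ᵐ[haar] v) (α : ℕ →₀ ℤ) :
    coeff u α = coeff v α := by
  refine integral_congr_ae ?_
  filter_upwards [h] with x hx
  rw [hx]

theorem inner_chi_chi (α β : ℕ →₀ ℤ) : inner ℂ (chi α) (chi β) = if α = β then (1 : ℂ) else 0 := by
  rw [← coeff_eq_inner_chi, coeff_congr (coeFn_chi β), coeff]
  simp only [← character_neg, ← character_add]
  rw [integral_character]
  congr 1
  rw [neg_add_eq_zero]

theorem orthonormal_chi : Orthonormal ℂ chi := by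
  rw [orthonormal_iff_ite]
  exact inner_chi_chi

/-- The indicator of a finite set, as a frequency. -/
def ind (S : Finset ℕ) : ℕ →₀ ℤ := Finsupp.indicator S fun _ _ => 1

theorem ind_apply (S : Finset ℕ) (i : ℕ) : ind S i = if i ∈ S then 1 else 0 := by
  simp [ind, Finsupp.indicator_apply]

theorem ind_nonneg (S : Finset ℕ) : 0 ≤ ind S := fun i => by
  rw [ind_apply]
  split_ifs <;> simp

theorem ind_injective : Function.Injective ind := by
  intro S T h
  ext i
  have := DFunLike.congr_fun h i
  rw [ind_apply, ind_apply] at this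
  by_cases h1 : i ∈ S <;> by_cases h2 : i ∈ T <;> simp_all

theorem character_ind (S : Finset ℕ) (x : UnitAddTorus ℕ) :
    character (ind S) x = ∏ i ∈ S, z i x := by
  rw [character, ind, Finsupp.prod_indicator_index (h := fun n a => fourier a (x n)) _
    (fun n _ => fourier_zero)]
  rfl

theorem ind_sub_ind {S B : Finset ℕ} (h : B ⊆ S) : ind S - ind B = ind (S \ B) := by
  ext i
  simp only [Finsupp.coe_sub, Pi.sub_apply, ind_apply, Finset.mem_sdiff]
  by_cases h1 : i ∈ B
  · simp [h1, h h1]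
  · simp [h1]

/-- Integer entries between `0` and an indicator are `0` or `1`. This confines the output of the
Hankel operator to negatives of indicators. -/
theorem eq_ind_of_le {S : Finset ℕ} {β : ℕ →₀ ℤ} (h0 : 0 ≤ β) (h : β ≤ ind S) :
    ∃ B ⊆ S, β = ind B := by
  refine ⟨β.support, fun i hi => ?_, ?_⟩
  · by_contra hS
    have h1 := h i
    have h2 : 0 ≤ β i := h0 i
    rw [ind_apply, if_neg hS] at h1
    exact Finsupp.mem_support_iff.1 hi (le_antisymm h1 h2)
  · ext i
    have h1 := h i
    have h2 : 0 ≤ β i := h0 i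
    rw [ind_apply] at h1 ⊢
    simp only [Finsupp.mem_support_iff]
    split_ifs at h1 ⊢ <;> omega

/-! ### Fourier expansion of the blocks and of the symbol -/

/-- The number `1 / √2`. -/
abbrev invSqrtTwo : ℝ := (Real.sqrt 2)⁻¹

/-- Expanding the product picks one variable from each pair; `t` records where the even one is
picked. -/
theorem block_eq_sum (n : ℕ) (x : UnitAddTorus ℕ) :
    block (n + 1) x =
      ((invSqrtTwo ^ (n + 1) : ℝ) : ℂ) * ∑ S ∈ transversals (n + 1), character (ind S) x := by
  have h : ∀ t ∈ (blockIndices (n + 1)).powerset,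
      (∏ i ∈ t, z (2 * i) x) * ∏ i ∈ blockIndices (n + 1) \ t, z (2 * i + 1) x =
        character (ind (choice (blockIndices (n + 1)) t)) x := by
    intro t _
    rw [character_ind, choice, Finset.prod_union (disjoint_images _ _),
      Finset.prod_image (fun a _ b _ h => by simpa using h),
      Finset.prod_image (fun a _ b _ h => by simpa using h)]
  change ∏ i ∈ blockIndices (n + 1), _ = _
  rw [Finset.prod_div_distrib, Finset.prod_const, card_blockIndices, Finset.prod_add,
    Finset.sum_congr rfl h, transversals, Finset.sum_image fun _ _ _ _ h => choice_injective _ h,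
    div_eq_inv_mul]
  push_cast
  rw [inv_pow]

theorem toLp_eq_continuousMap_toLp (u : C(UnitAddTorus ℕ, ℂ)) :
    (memLp_of_continuous u.continuous 2).toLp u = ContinuousMap.toLp 2 haar ℂ u := by
  refine Lp.ext ?_
  filter_upwards [(memLp_of_continuous u.continuous 2).coeFn_toLp,
    ContinuousMap.coeFn_toLp (p := 2) (𝕜 := ℂ) haar u] with x h1 h2
  rw [h1, h2]

theorem blockL2_eq_sum (n : ℕ) :
    blockL2 (n + 1) =
      ((invSqrtTwo ^ (n + 1) : ℝ) : ℂ) • ∑ S ∈ transversals (n + 1), chi (ind S) := by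
  have h : ∀ S, chi (ind S) = ContinuousMap.toLp 2 haar ℂ ⟨_, continuous_character (ind S)⟩ :=
    fun S => toLp_eq_continuousMap_toLp ⟨_, continuous_character (ind S)⟩
  simp only [h]
  rw [← map_sum, ← map_smul]
  refine (toLp_eq_continuousMap_toLp ⟨_, continuous_block (n + 1)⟩).trans (congrArg _ ?_)
  ext x
  simp [block_eq_sum]

theorem inner_chi_blockL2 (n : ℕ) (α : ℕ →₀ ℤ) :
    inner ℂ (chi α) (blockL2 (n + 1)) =
      if ∃ S ∈ transversals (n + 1), α = ind S then ((invSqrtTwo ^ (n + 1) : ℝ) : ℂ) else 0 := by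
  rw [blockL2_eq_sum, inner_smul_right, inner_sum]
  simp only [inner_chi_chi]
  split_ifs with h
  · obtain ⟨S, hS, rfl⟩ := h
    simp only [ind_injective.eq_iff]
    rw [Finset.sum_ite_eq, if_pos hS, mul_one]
  · rw [Finset.sum_eq_zero, mul_zero]
    exact fun S hS => if_neg fun h' => h ⟨S, hS, h'⟩

theorem invSqrtTwo_sq : invSqrtTwo ^ 2 * 2 = 1 := by
  rw [invSqrtTwo, inv_pow, Real.sq_sqrt zero_le_two]
  norm_num

theorem inner_blockL2_blockL2 (m n : ℕ) :
    inner ℂ (blockL2 (m + 1)) (blockL2 (n + 1)) = if m = n then (1 : ℂ) else 0 := by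
  nth_rw 1 [blockL2_eq_sum]
  rw [inner_smul_left, sum_inner]
  split_ifs with h
  · subst h
    rw [Finset.sum_congr rfl fun S hS => (inner_chi_blockL2 m (ind S)).trans
      (if_pos ⟨S, hS, rfl⟩), Finset.sum_const, card_transversals, card_blockIndices, nsmul_eq_mul,
      Complex.conj_ofReal]
    norm_cast
    calc _ = (invSqrtTwo ^ 2 * 2) ^ (m + 1) := by push_cast; ring
      _ = 1 := by rw [invSqrtTwo_sq, one_pow]
  · rw [Finset.sum_eq_zero, mul_zero]
    intro S hS
    rw [inner_chi_blockL2, if_neg]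
    rintro ⟨T, hT, hST⟩
    obtain rfl := ind_injective hST
    exact h (index_unique hS hT)

theorem orthonormal_blockL2 : Orthonormal ℂ fun n => blockL2 (n + 1) := by
  rw [orthonormal_iff_ite]
  exact inner_blockL2_blockL2

/-- The coefficients `√6 / (π (n + 1))` of the symbol. -/
def amplitude (n : ℕ) : ℝ := Real.sqrt 6 / Real.pi * (1 / ((n : ℝ) + 1))

theorem amplitude_pos (n : ℕ) : 0 < amplitude n := by
  unfold amplitude
  positivity

/-- The Basel sum, which explains the normalization `√6 / π`. -/
theorem hasSum_amplitude_sq : HasSum (fun n => amplitude n ^ 2) 1 := by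
  -- The removed term of index zero is `1 / 0 ^ 2`, which is `0` by convention.
  have h := (hasSum_nat_add_iff' 1).2 hasSum_zeta_two
  simp only [Finset.range_one, Finset.sum_singleton, Nat.cast_zero, ne_eq, OfNat.ofNat_ne_zero,
    not_false_eq_true, zero_pow, div_zero, sub_zero] at h
  have h6 := h.mul_left (6 / Real.pi ^ 2)
  have e : 6 / Real.pi ^ 2 * (Real.pi ^ 2 / 6) = 1 := by
    field_simp
  rw [e] at h6
  have h2 : (fun n => amplitude n ^ 2) =
      fun n : ℕ => 6 / Real.pi ^ 2 * (1 / ((n + 1 : ℕ) : ℝ) ^ 2) := by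
    funext n
    rw [amplitude, mul_pow, div_pow, div_pow, one_pow, Real.sq_sqrt (by norm_num)]
    push_cast
    rfl
  rwa [h2]

theorem amplitude_le_one (n : ℕ) : amplitude n ≤ 1 := by
  have h := le_hasSum hasSum_amplitude_sq n fun m _ => sq_nonneg _
  exact (sq_le_one_iff₀ (amplitude_pos n).le).1 h

/-- The symbol as a function in `L²`. -/
theorem exists_hasSum_symbol : ∃ φ : L 2, ‖φ‖ = 1 ∧
    HasSum (fun n => ((amplitude n : ℝ) : ℂ) • blockL2 (n + 1)) φ := by
  have hmem : Memℓp (fun n => ((amplitude n : ℝ) : ℂ)) 2 := by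
    rw [memℓp_gen_iff (by norm_num)]
    simpa using hasSum_amplitude_sq.summable
  let c : lp (fun _ : ℕ => ℂ) 2 := ⟨_, hmem⟩
  refine ⟨orthonormal_blockL2.orthogonalFamily.linearIsometry c, ?_, ?_⟩
  · rw [LinearIsometry.norm_map]
    have h := lp.norm_rpow_eq_tsum (p := 2) (by norm_num) c
    have e : ∀ n, ‖c n‖ ^ ENNReal.toReal 2 = amplitude n ^ 2 := fun n => by
      change ‖((amplitude n : ℝ) : ℂ)‖ ^ _ = _
      simp
    simp only [e, hasSum_amplitude_sq.tsum_eq] at h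
    have h0 := norm_nonneg c
    rcases (by simpa using h : ‖c‖ = 1 ∨ ‖c‖ = -1) with h1 | h1
    · exact h1
    · linarith
  · have h := orthonormal_blockL2.orthogonalFamily.hasSum_linearIsometry c
    simp only [LinearIsometry.toSpanSingleton_apply] at h
    exact h

/-! ### The Hankel operator -/

theorem tsum_enorm_sq_lp {ι : Type*} (a : lp (fun _ : ι => ℂ) 2) :
    ∑' i, ‖a i‖ₑ ^ 2 = ‖a‖ₑ ^ 2 := by
  have h := lp.norm_rpow_eq_tsum (p := 2) (by norm_num) a
  have hs := (lp.memℓp a).summable (by norm_num)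
  simp only [ENNReal.toReal_ofNat, Real.rpow_ofNat] at h hs
  rw [← ofReal_norm, ← ENNReal.ofReal_pow (norm_nonneg _), h,
    ENNReal.ofReal_tsum_of_nonneg (fun i => by positivity) hs]
  refine tsum_congr fun i => ?_
  rw [← ofReal_norm, ENNReal.ofReal_pow (norm_nonneg _)]

theorem memℓp_of_tsum_enorm_sq_ne_top {ι : Type*} {a : ι → ℂ} (h : ∑' i, ‖a i‖ₑ ^ 2 ≠ ∞) :
    Memℓp a 2 := by
  rw [memℓp_gen_iff (by norm_num)]
  have := ENNReal.summable_toReal h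
  simpa using this

theorem tsum_enorm_inner_sq_le {ι : Type*} {v : ι → L 2} (hv : Orthonormal ℂ v) (f : L 2) :
    ∑' i, ‖(inner ℂ (v i) f : ℂ)‖ₑ ^ 2 ≤ ‖f‖ₑ ^ 2 := by
  have h := hv.tsum_inner_products_le (x := f)
  have hs := hv.inner_products_summable (x := f)
  rw [← ofReal_norm, ← ENNReal.ofReal_pow (norm_nonneg _)]
  refine le_trans (le_of_eq ?_) (ENNReal.ofReal_le_ofReal h)
  rw [ENNReal.ofReal_tsum_of_nonneg (fun i => by positivity) hs]
  refine tsum_congr fun i => ?_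
  rw [← ofReal_norm, ENNReal.ofReal_pow (norm_nonneg _)]

theorem memLp_character_mul (α : ℕ →₀ ℤ) (f : L 2) :
    MemLp (fun x => character α x * f x) 2 haar :=
  (Lp.memLp f).mono ((continuous_character α).aestronglyMeasurable.mul (Lp.aestronglyMeasurable f))
    (.of_forall fun x => by rw [norm_mul, norm_character, one_mul])

/-- Multiplication of a function in `L²` by a character. -/
def chiMul (α : ℕ →₀ ℤ) (f : L 2) : L 2 := (memLp_character_mul α f).toLp _

theorem coeff_conj_mul_eq_inner (φ f : L 2) (α : ℕ →₀ ℤ) :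
    coeff (fun x => conj (φ x) * f x) α = inner ℂ (chiMul α φ) f := by
  rw [L2.inner_def, coeff]
  refine integral_congr_ae ?_
  filter_upwards [(memLp_character_mul α φ).coeFn_toLp] with x hx
  rw [chiMul, hx, RCLike.inner_apply, map_mul]
  ring

theorem inner_chiMul_left (φ f : L 2) (α : ℕ →₀ ℤ) :
    (inner ℂ (chiMul α φ) f : ℂ) = inner ℂ φ (chiMul (-α) f) := by
  rw [L2.inner_def, L2.inner_def]
  refine integral_congr_ae ?_
  filter_upwards [(memLp_character_mul α φ).coeFn_toLp,
    (memLp_character_mul (-α) f).coeFn_toLp] with x hx hy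
  rw [chiMul, chiMul, hx, hy, RCLike.inner_apply, RCLike.inner_apply, map_mul, character_neg]
  ring

theorem chiMul_chi (α β : ℕ →₀ ℤ) : chiMul α (chi β) = chi (α + β) := by
  refine Lp.ext ?_
  filter_upwards [(memLp_character_mul α (chi β)).coeFn_toLp, coeFn_chi β, coeFn_chi (α + β)]
    with x h1 h2 h3
  rw [chiMul, h1, h2, h3, character_add]

theorem inner_chi_chiMul (f : L 2) (α β : ℕ →₀ ℤ) :
    (inner ℂ (chi α) (chiMul β f) : ℂ) = coeff f (α - β) := by
  have h := inner_chiMul_left (chi α) f (-β)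
  rw [neg_neg] at h
  rw [← h, chiMul_chi, coeff_eq_inner_chi, neg_add_eq_sub]

theorem coeff_star (f : L 2) (α : ℕ →₀ ℤ) : coeff (star f : L 2) α = conj (coeff f (-α)) := by
  rw [coeff, coeff, ← integral_conj]
  refine integral_congr_ae ?_
  filter_upwards [Lp.coeFn_star f] with x hx
  rw [hx, map_mul, character_neg, RingHomCompTriple.comp_apply, Pi.star_apply]
  rfl

theorem chi_mem_hardy {α : ℕ →₀ ℤ} (hα : 0 ≤ α) : chi α ∈ hardy := by
  intro β hβ
  rw [coeff_eq_inner_chi, inner_chi_chi, if_neg]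
  rintro rfl
  exact hβ hα

theorem blockL2_mem_hardy (n : ℕ) : blockL2 (n + 1) ∈ hardy := by
  rw [blockL2_eq_sum]
  exact hardy.smul_mem _ (hardy.sum_mem fun S _ => chi_mem_hardy (ind_nonneg S))

section

variable {φ : L 2}

theorem symbol_mem_hardy (hφ : HasSum (fun n => ((amplitude n : ℝ) : ℂ) • blockL2 (n + 1)) φ) :
    φ ∈ hardy :=
  isClosed_hardy.mem_of_tendsto hφ (.of_forall fun _ =>
    hardy.sum_mem fun n _ => hardy.smul_mem _ (blockL2_mem_hardy n))

/-- The moduli of the Fourier coefficients of the symbol. -/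
abbrev symbolMass : Finset ℕ → ℝ≥0∞ :=
  mass (fun n => ENNReal.ofReal (amplitude n)) (ENNReal.ofReal invSqrtTwo)

theorem ofReal_invSqrtTwo_sq : ENNReal.ofReal invSqrtTwo ^ 2 * 2 = 1 := by
  rw [← ENNReal.ofReal_pow (by positivity), ← ENNReal.ofReal_ofNat,
    ← ENNReal.ofReal_mul (by positivity), invSqrtTwo_sq, ENNReal.ofReal_one]

theorem tsum_ofReal_amplitude_sq : ∑' n, ENNReal.ofReal (amplitude n) ^ 2 = 1 := by
  simp only [← ENNReal.ofReal_pow (amplitude_pos _).le]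
  rw [← ENNReal.ofReal_tsum_of_nonneg (fun n => sq_nonneg _) hasSum_amplitude_sq.summable,
    hasSum_amplitude_sq.tsum_eq, ENNReal.ofReal_one]

theorem enorm_ofReal {x : ℝ} (hx : 0 ≤ x) : ‖(x : ℂ)‖ₑ = ENNReal.ofReal x := by
  rw [← ofReal_norm, Complex.norm_of_nonneg hx]

theorem tsum_sq_symbolMass_le (f : Finset ℕ → ℝ≥0∞) :
    ∑' B, (∑' S, symbolMass S * (if B ⊆ S then f (S \ B) else 0)) ^ 2 ≤ ∑' A, f A ^ 2 :=
  tsum_sq_mass_le ofReal_invSqrtTwo_sq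
    (fun n => (ENNReal.ofReal_pos.2 (amplitude_pos n)).ne')
    (fun n => ENNReal.ofReal_le_one.2 (amplitude_le_one n)) tsum_ofReal_amplitude_sq f

/-- The triangle inequality, over blocks and then over monomials. Passing to moduli reduces
boundedness to the Schur test for a nonnegative matrix. -/
theorem enorm_inner_symbol_le
    (hφ : HasSum (fun n => ((amplitude n : ℝ) : ℂ) • blockL2 (n + 1)) φ) (h : L 2) :
    ‖(inner ℂ φ h : ℂ)‖ₑ ≤ ∑' S, symbolMass S * ‖(inner ℂ (chi (ind S)) h : ℂ)‖ₑ := by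
  rw [tsum_mass_mul, ← enorm_neg, ← inner_conj_symm, enorm_neg, RCLike.enorm_conj]
  have h1 := (innerSL ℂ h).hasSum hφ
  rw [← innerSL_apply_apply ℂ, ← h1.tsum_eq]
  refine (enorm_tsum_le_tsum_enorm).trans (ENNReal.tsum_le_tsum fun n => ?_)
  rw [innerSL_apply_apply, blockL2_eq_sum, inner_smul_right, inner_smul_right, inner_sum,
    enorm_mul, enorm_mul, enorm_ofReal (amplitude_pos n).le, enorm_ofReal (by positivity),
    ENNReal.ofReal_pow (by positivity), mul_assoc]
  gcongr
  refine (enorm_sum_le _ _).trans (Finset.sum_le_sum fun S _ => ?_)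
  rw [← inner_conj_symm, RCLike.enorm_conj]

theorem inner_blockL2_symbol
    (hφ : HasSum (fun n => ((amplitude n : ℝ) : ℂ) • blockL2 (n + 1)) φ) (n : ℕ) :
    (inner ℂ (blockL2 (n + 1)) φ : ℂ) = amplitude n := by
  have h1 := (innerSL ℂ (blockL2 (n + 1))).hasSum hφ
  have key : ∀ m, innerSL ℂ (blockL2 (n + 1)) (((amplitude m : ℝ) : ℂ) • blockL2 (m + 1)) =
      amplitude m * if n = m then 1 else 0 := fun m => by
    rw [innerSL_apply_apply, inner_smul_right, inner_blockL2_blockL2]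
  simp only [key] at h1
  have h2 := hasSum_single (f := fun m => (amplitude m : ℂ) * if n = m then 1 else 0) n
    fun m hm => by rw [if_neg hm.symm, mul_zero]
  simpa using h1.unique h2

theorem inner_chi_symbol
    (hφ : HasSum (fun n => ((amplitude n : ℝ) : ℂ) • blockL2 (n + 1)) φ) {n : ℕ} {S : Finset ℕ}
    (hS : S ∈ transversals (n + 1)) :
    (inner ℂ (chi (ind S)) φ : ℂ) = amplitude n * ((invSqrtTwo ^ (n + 1) : ℝ) : ℂ) := by
  have h1 := (innerSL ℂ (chi (ind S))).hasSum hφ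
  refine h1.unique ?_
  have key : ∀ m, innerSL ℂ (chi (ind S)) (((amplitude m : ℝ) : ℂ) • blockL2 (m + 1)) =
      amplitude m * if ∃ T ∈ transversals (m + 1), ind S = ind T then
        ((invSqrtTwo ^ (m + 1) : ℝ) : ℂ) else 0 := fun m => by
    rw [innerSL_apply_apply, inner_smul_right, inner_chi_blockL2]
  have h2 : innerSL ℂ (chi (ind S)) (((amplitude n : ℝ) : ℂ) • blockL2 (n + 1)) =
      amplitude n * ((invSqrtTwo ^ (n + 1) : ℝ) : ℂ) := by
    rw [key, if_pos ⟨S, hS, rfl⟩]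
  rw [← h2]
  refine hasSum_single n fun m hm => ?_
  change innerSL ℂ (chi (ind S)) (((amplitude m : ℝ) : ℂ) • blockL2 (m + 1)) = 0
  rw [key, if_neg, mul_zero]
  rintro ⟨T, hT, h⟩
  obtain rfl := ind_injective h
  exact hm (index_unique hT hS)

/-- Used for the lower bound on the operator norm, where this direction is enough. -/
theorem symbolMass_le_enorm_inner
    (hφ : HasSum (fun n => ((amplitude n : ℝ) : ℂ) • blockL2 (n + 1)) φ) (S : Finset ℕ) :
    symbolMass S ≤ ‖(inner ℂ φ (chi (ind S)) : ℂ)‖ₑ := by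
  by_cases h : ∃ n, S ∈ transversals (n + 1)
  · obtain ⟨n, hn⟩ := h
    rw [symbolMass, mass_of_mem hn, ← inner_conj_symm, RCLike.enorm_conj, inner_chi_symbol hφ hn,
      enorm_mul, enorm_ofReal (amplitude_pos n).le, enorm_ofReal (by positivity),
      ENNReal.ofReal_pow (by positivity)]
  · rw [symbolMass, mass_of_forall_notMem (not_exists.1 h)]
    exact zero_le

/-- The coefficient of `chiMul (ind B) f` at `ind S` is that of `f` at `ind S - ind B`. This has a
negative entry unless `B ⊆ S`, and then `f` has no such coefficient. -/
theorem enorm_inner_symbol_chiMul_le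
    (hφ : HasSum (fun n => ((amplitude n : ℝ) : ℂ) • blockL2 (n + 1)) φ) {f : L 2}
    (hf : f ∈ hardy) (B : Finset ℕ) :
    ‖(inner ℂ φ (chiMul (ind B) f) : ℂ)‖ₑ ≤
      ∑' S, symbolMass S * (if B ⊆ S then ‖coeff f (ind (S \ B))‖ₑ else 0) := by
  refine (enorm_inner_symbol_le hφ _).trans (ENNReal.tsum_le_tsum fun S => ?_)
  gcongr
  rw [inner_chi_chiMul]
  split_ifs with h
  · rw [ind_sub_ind h]
  · rw [hf, enorm_zero]
    intro h0
    refine h fun i hi => ?_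
    have := h0 i
    by_contra hS
    simp [ind_apply, hi, hS] at this

/-- A nonzero contribution needs `β ≤ ind S` for some `S`, which makes `β` an indicator. -/
theorem inner_symbol_chiMul_eq_zero
    (hφ : HasSum (fun n => ((amplitude n : ℝ) : ℂ) • blockL2 (n + 1)) φ) {f : L 2}
    (hf : f ∈ hardy) {β : ℕ →₀ ℤ} (hβ : 0 ≤ β) (hβ' : ∀ B, β ≠ ind B) :
    (inner ℂ φ (chiMul β f) : ℂ) = 0 := by
  rw [← enorm_eq_zero, ← nonpos_iff_eq_zero]
  refine (enorm_inner_symbol_le hφ _).trans (le_of_eq (ENNReal.tsum_eq_zero.2 fun S => ?_))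
  rw [inner_chi_chiMul, hf, enorm_zero, mul_zero]
  intro h0
  obtain ⟨B, -, hB⟩ := eq_ind_of_le hβ (sub_nonneg.1 h0)
  exact hβ' B hB

/-- The Schur test applied to the moduli of the coefficients of `f` at indicators, followed by
Bessel's inequality. -/
theorem tsum_enorm_inner_symbol_le
    (hφ : HasSum (fun n => ((amplitude n : ℝ) : ℂ) • blockL2 (n + 1)) φ) {f : L 2}
    (hf : f ∈ hardy) :
    ∑' B, ‖(inner ℂ (chiMul (-ind B) φ) f : ℂ)‖ₑ ^ 2 ≤ ‖f‖ₑ ^ 2 := by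
  calc _ ≤ ∑' B, (∑' S, symbolMass S *
        (if B ⊆ S then ‖coeff f (ind (S \ B))‖ₑ else 0)) ^ 2 := by
        refine ENNReal.tsum_le_tsum fun B => ?_
        rw [inner_chiMul_left, neg_neg]
        gcongr
        exact enorm_inner_symbol_chiMul_le hφ hf B
    _ ≤ ∑' A, ‖coeff f (ind A)‖ₑ ^ 2 := tsum_sq_symbolMass_le fun A => ‖coeff f (ind A)‖ₑ
    _ ≤ _ := by
        simp only [coeff_eq_inner_chi]
        exact tsum_enorm_inner_sq_le (orthonormal_chi.comp _ ind_injective) f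

/-- The Fourier coefficients of `conj φ * f` at the negatives of indicators, as a sequence
in `ℓ²`. -/
def hankelCoeff (hφ : HasSum (fun n => ((amplitude n : ℝ) : ℂ) • blockL2 (n + 1)) φ) :
    hardy →ₗ[ℂ] lp (fun _ : Finset ℕ => ℂ) 2 where
  toFun f := ⟨fun B => inner ℂ (chiMul (-ind B) φ) (f : L 2), memℓp_of_tsum_enorm_sq_ne_top
    (ne_top_of_le_ne_top (ENNReal.pow_ne_top enorm_ne_top)
      (tsum_enorm_inner_symbol_le hφ f.2))⟩
  map_add' f g := by
    ext B
    exact inner_add_right _ _ _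
  map_smul' c f := by
    ext B
    exact inner_smul_right _ _ _

theorem hankelCoeff_apply (hφ : HasSum (fun n => ((amplitude n : ℝ) : ℂ) • blockL2 (n + 1)) φ)
    (f : hardy) (B : Finset ℕ) :
    hankelCoeff hφ f B = inner ℂ (chiMul (-ind B) φ) (f : L 2) := rfl

theorem norm_hankelCoeff_le (hφ : HasSum (fun n => ((amplitude n : ℝ) : ℂ) • blockL2 (n + 1)) φ)
    (f : hardy) : ‖hankelCoeff hφ f‖ ≤ 1 * ‖f‖ := by
  have h := tsum_enorm_inner_symbol_le hφ f.2
  simp only [← hankelCoeff_apply hφ] at h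
  rw [tsum_enorm_sq_lp, ENNReal.pow_le_pow_left_iff two_ne_zero, ← ofReal_norm, ← ofReal_norm,
    ENNReal.ofReal_le_ofReal_iff (norm_nonneg _)] at h
  rwa [one_mul]

end

theorem orthonormal_chi_neg_ind : Orthonormal ℂ fun B => chi (-ind B) :=
  orthonormal_chi.comp (fun B => -ind B) (neg_injective.comp ind_injective)

/-- The function in `L²` with given Fourier coefficients at the negatives of indicators. -/
def synthesis : lp (fun _ : Finset ℕ => ℂ) 2 →ₗᵢ[ℂ] L 2 :=
  orthonormal_chi_neg_ind.orthogonalFamily.linearIsometry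

theorem hasSum_inner_synthesis (a : lp (fun _ : Finset ℕ => ℂ) 2) (β : ℕ →₀ ℤ) :
    HasSum (fun B => a B * if β = ind B then (1 : ℂ) else 0) (coeff (synthesis a) (-β)) := by
  have h := orthonormal_chi_neg_ind.orthogonalFamily.hasSum_linearIsometry a
  rw [coeff_eq_inner_chi]
  have h2 := (innerSL ℂ (chi (-β))).hasSum h
  simp only [LinearIsometry.toSpanSingleton_apply, innerSL_apply_apply,
    inner_smul_right, inner_chi_chi, neg_inj] at h2
  exact h2

theorem coeff_synthesis_of_forall_ne (a : lp (fun _ : Finset ℕ => ℂ) 2) {β : ℕ →₀ ℤ}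
    (hβ : ∀ B, β ≠ ind B) : coeff (synthesis a) (-β) = 0 := by
  refine (hasSum_inner_synthesis a β).unique ?_
  simp only [hβ, if_false, mul_zero]
  exact hasSum_zero

theorem coeff_synthesis_neg_ind (a : lp (fun _ : Finset ℕ => ℂ) 2) (B : Finset ℕ) :
    coeff (synthesis a) (-ind B) = a B := by
  refine (hasSum_inner_synthesis a _).unique ?_
  have h := hasSum_single (f := fun B' => a B' * if ind B = ind B' then (1 : ℂ) else 0) B
    fun B' hB' => by rw [if_neg fun h => hB' (ind_injective h).symm, mul_zero]
  simpa using h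

theorem synthesis_mem_conjHardy (a : lp (fun _ : Finset ℕ => ℂ) 2) :
    synthesis a ∈ conjHardy := by
  intro α hα
  rw [coeff_star, coeff_synthesis_of_forall_ne, map_zero]
  rintro B rfl
  exact hα (ind_nonneg B)

theorem exists_hankelOperator {φ : hardy} (hφ : IsSymbol φ) :
    ∃ H : hardy →L[ℂ] conjHardy, IsHankelOperator φ H ∧ ‖H‖ = 1 := by
  have hφ' : HasSum (fun n => ((amplitude n : ℝ) : ℂ) • blockL2 (n + 1)) (φ : L 2) := hφ
  let T : hardy →L[ℂ] lp (fun _ : Finset ℕ => ℂ) 2 :=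
    (hankelCoeff hφ').mkContinuous 1 (norm_hankelCoeff_le hφ')
  let H : hardy →L[ℂ] conjHardy :=
    (synthesis.toContinuousLinearMap.comp T).codRestrict conjHardy
      fun f => synthesis_mem_conjHardy _
  have hH : ∀ f, ((H f : conjHardy) : L 2) = synthesis (hankelCoeff hφ' f) := fun f => rfl
  have hnorm : ∀ f, ‖H f‖ = ‖hankelCoeff hφ' f‖ := fun f =>
    (congrArg norm (hH f)).trans (synthesis.norm_map _)
  refine ⟨H, ?_, le_antisymm ?_ ?_⟩
  · intro f α hα
    obtain ⟨β, rfl⟩ : ∃ β, α = -β := ⟨-α, (neg_neg α).symm⟩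
    rw [hH, coeff_conj_mul_eq_inner]
    by_cases h : ∃ B, β = ind B
    · obtain ⟨B, rfl⟩ := h
      rw [coeff_synthesis_neg_ind, hankelCoeff_apply]
    · push Not at h
      rw [coeff_synthesis_of_forall_ne _ h, inner_chiMul_left, neg_neg,
        inner_symbol_chiMul_eq_zero hφ' f.2 (neg_nonpos.1 hα) h]
  · refine H.opNorm_le_bound zero_le_one fun f => ?_
    rw [hnorm]
    exact norm_hankelCoeff_le hφ' f
  -- The constant `1` is extremal: its image has the conjugated coefficients of the symbol, whose
  -- squares already sum to one.
  · have h1 : ‖chi 0‖ = 1 := orthonormal_chi.1 0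
    let e : hardy := ⟨chi 0, chi_mem_hardy le_rfl⟩
    have he : ‖e‖ = 1 := h1
    have h2 : (1 : ℝ≥0∞) ≤ ‖hankelCoeff hφ' e‖ₑ ^ 2 := by
      rw [← tsum_mass_sq ofReal_invSqrtTwo_sq tsum_ofReal_amplitude_sq, ← tsum_enorm_sq_lp]
      refine ENNReal.tsum_le_tsum fun B => ?_
      gcongr
      rw [hankelCoeff_apply, inner_chiMul_left, neg_neg, chiMul_chi, add_zero]
      exact symbolMass_le_enorm_inner hφ' B
    rw [← one_pow 2, ENNReal.pow_le_pow_left_iff two_ne_zero, ← ofReal_norm,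
      ENNReal.one_le_ofReal, ← hnorm] at h2
    have h3 := H.le_opNorm e
    rw [he, mul_one] at h3
    exact h2.trans h3

/-! ### Independent pairs and the `L^q` norms of the blocks -/

/-- The Haar measure of the two-dimensional torus. -/
abbrev haarPair : Measure (UnitAddCircle × UnitAddCircle) :=
  (AddCircle.haarAddCircle : Measure UnitAddCircle).prod AddCircle.haarAddCircle

/-- The coordinates with indices `2 i` and `2 i + 1` form independent pairs. -/
theorem iIndepFun_pairs : ProbabilityTheory.iIndepFun
    (fun (i : ℕ) (x : UnitAddTorus ℕ) => (x (2 * i), x (2 * i + 1))) haar := by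
  -- Reindexing along `(i, j) ↦ 2 i + j` and currying turns the product measure into a product over
  -- `i` of measures on pairs.
  have hinj : Function.Injective fun p : ℕ × Fin 2 => 2 * p.1 + (p.2 : ℕ) := by
    rintro ⟨i, j⟩ ⟨i', j'⟩ h
    have hj := j.2
    have hj' := j'.2
    dsimp only at h
    obtain rfl : i = i' := by omega
    exact Prod.ext rfl (Fin.ext (by dsimp only; omega))
  have h1 := Measure.map_infinitePi_infinitePi_of_inj
    (P := fun _ : ℕ => (AddCircle.haarAddCircle : Measure UnitAddCircle)) hinj
  have h2 := Measure.infinitePi_map_curry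
    (fun (_ : ℕ) (_ : Fin 2) => (AddCircle.haarAddCircle : Measure UnitAddCircle))
  rw [← h1, Measure.map_map (by fun_prop) (by fun_prop)] at h2
  have h3 : MeasurePreserving
      (fun (x : UnitAddTorus ℕ) (i : ℕ) (j : Fin 2) => x (2 * i + (j : ℕ))) haar
      (Measure.infinitePi fun _ : ℕ => Measure.infinitePi fun _ : Fin 2 =>
        (AddCircle.haarAddCircle : Measure UnitAddCircle)) := ⟨by fun_prop, h2⟩
  have h4 : ProbabilityTheory.iIndepFun
      (fun (i : ℕ) (x : UnitAddTorus ℕ) (j : Fin 2) => x (2 * i + (j : ℕ))) haar := by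
    rw [ProbabilityTheory.iIndepFun_iff_map_fun_eq_infinitePi_map (by fun_prop), h3.map_eq]
    congr 1
    funext i
    exact (((measurePreserving_eval_infinitePi _ i).comp h3).map_eq).symm
  exact h4.comp (fun _ y => (y 0, y 1)) fun _ => by fun_prop

theorem measurePreserving_pair (i : ℕ) :
    MeasurePreserving (fun x : UnitAddTorus ℕ => (x (2 * i), x (2 * i + 1))) haar haarPair :=
  ⟨by fun_prop, Measure.infinitePi_map_eval_prod (Nat.lt_succ_self _).ne⟩

theorem integral_prod_pairs (s : Finset ℕ) {g : UnitAddCircle × UnitAddCircle → ℝ}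
    (hg : Continuous g) :
    ∫ x, ∏ i ∈ s, g (x (2 * i), x (2 * i + 1)) ∂haar = (∫ y, g y ∂haarPair) ^ s.card := by
  have hind := iIndepFun_pairs.precomp (g := fun i : s => (i : ℕ)) Subtype.val_injective
  have h := hind.integral_fun_prod_comp (f := fun (_ : s) y => g y)
    (fun i => (measurePreserving_pair i).measurable.aemeasurable)
    (fun i => hg.aestronglyMeasurable)
  have h2 : ∀ i : ℕ, ∫ x : UnitAddTorus ℕ, g (x (2 * i), x (2 * i + 1)) ∂haar =
      ∫ y, g y ∂haarPair := fun i => by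
    rw [← (measurePreserving_pair i).map_eq, integral_map]
    · exact (measurePreserving_pair i).measurable.aemeasurable
    · exact hg.aestronglyMeasurable
  simp only [h2, Finset.prod_const, Finset.card_univ, Fintype.card_coe] at h
  rw [← h]
  refine integral_congr_ae (.of_forall fun x => ?_)
  exact (Finset.prod_coe_sort s fun i => g (x (2 * i), x (2 * i + 1))).symm

/-- The function `(z₁ + z₂) / √2` on the two-dimensional torus. -/
def pairFactor (y : UnitAddCircle × UnitAddCircle) : ℂ :=
  (fourier 1 y.1 + fourier 1 y.2) / (Real.sqrt 2 : ℂ)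

theorem continuous_pairFactor : Continuous pairFactor := by
  unfold pairFactor
  fun_prop

theorem fourier_mul_conj (n : ℤ) (t : UnitAddCircle) : fourier n t * conj (fourier n t) = 1 := by
  rw [← fourier_neg, ← fourier_add, add_neg_cancel, fourier_zero]

theorem norm_pairFactor_sq (y : UnitAddCircle × UnitAddCircle) :
    ‖pairFactor y‖ ^ 2 = 1 + (fourier 1 y.1 * fourier (-1) y.2 : ℂ).re := by
  have h1 := fourier_mul_conj 1 y.1
  have h2 := fourier_mul_conj 1 y.2
  rw [Complex.mul_conj, ← Complex.ofReal_one, Complex.ofReal_inj] at h1 h2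
  rw [pairFactor, norm_div, div_pow, Complex.norm_of_nonneg (Real.sqrt_nonneg 2),
    Real.sq_sqrt zero_le_two, ← Complex.normSq_eq_norm_sq, Complex.normSq_add, h1, h2, fourier_neg]
  ring

theorem integrable_of_continuous_pair {g : UnitAddCircle × UnitAddCircle → ℝ}
    (hg : Continuous g) : Integrable g haarPair :=
  hg.integrable_of_hasCompactSupport (HasCompactSupport.of_compactSpace g)

theorem integral_norm_pairFactor_sq : ∫ y, ‖pairFactor y‖ ^ 2 ∂haarPair = 1 := by
  have hc : Continuous fun y : UnitAddCircle × UnitAddCircle =>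
      (fourier 1 y.1 * fourier (-1) y.2 : ℂ) := by fun_prop
  have hi : Integrable (fun y : UnitAddCircle × UnitAddCircle =>
      (fourier 1 y.1 * fourier (-1) y.2 : ℂ)) haarPair :=
    hc.integrable_of_hasCompactSupport (HasCompactSupport.of_compactSpace _)
  have hre : Integrable (fun y : UnitAddCircle × UnitAddCircle =>
      (fourier 1 y.1 * fourier (-1) y.2 : ℂ).re) haarPair := hi.re
  simp only [norm_pairFactor_sq]
  rw [integral_add (integrable_const _) hre, integral_const, probReal_univ, one_smul]
  have h := integral_re hi
  simp only [RCLike.re_to_complex] at h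
  rw [h, integral_prod_mul (fun t => fourier 1 t) (fun t => fourier (-1) t), integral_fourier]
  simp

/-- The norm of `(z₁ + z₂) / √2` in `L^q` is smaller than one when `q < 2`. -/
theorem integral_norm_pairFactor_rpow_lt_one {q : ℝ} (h0 : 0 < q) (h2 : q < 2) :
    ∫ y, ‖pairFactor y‖ ^ q ∂haarPair < 1 := by
  -- `D` is the defect in Bernoulli's inequality `(1 + s) ^ (q/2) ≤ 1 + (q/2) s` for `s = |F|² - 1`,
  -- with `F` the pair factor. Since `s` has mean zero, it suffices that `D` has positive integral.
  set D : UnitAddCircle × UnitAddCircle → ℝ :=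
    fun y => 1 + q / 2 * (‖pairFactor y‖ ^ 2 - 1) - ‖pairFactor y‖ ^ q with hD
  have hcq : Continuous fun y => ‖pairFactor y‖ ^ q :=
    continuous_pairFactor.norm.rpow_const fun _ => Or.inr h0.le
  have hc2 : Continuous fun y => ‖pairFactor y‖ ^ 2 := continuous_pairFactor.norm.pow 2
  have hc : Continuous D := by
    have hc1 : Continuous fun y => 1 + q / 2 * (‖pairFactor y‖ ^ 2 - 1) := by fun_prop
    exact hc1.sub hcq
  have hpow : ∀ y, (1 + (‖pairFactor y‖ ^ 2 - 1)) ^ (q / 2) = ‖pairFactor y‖ ^ q := fun y => by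
    rw [add_sub_cancel, ← Real.rpow_natCast, ← Real.rpow_mul (norm_nonneg _)]
    congr 1
    push_cast
    ring
  have hs : ∀ y, -1 ≤ ‖pairFactor y‖ ^ 2 - 1 := fun y => by linarith [sq_nonneg ‖pairFactor y‖]
  have hnonneg : 0 ≤ D := fun y => by
    have := rpow_one_add_le_one_add_mul_self (hs y) (p := q / 2) (by linarith) (by linarith)
    rw [hpow] at this
    exact sub_nonneg.2 this
  -- At the identity both coordinates equal `1`, so `s = 1` and Bernoulli is strict. Continuity and
  -- nonnegativity of `D` then give a positive integral.
  have hne : D 0 ≠ 0 := by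
    intro h
    have hz : ‖pairFactor 0‖ ^ 2 - 1 = 1 := by
      rw [norm_pairFactor_sq]
      simp
    have := rpow_one_add_lt_one_add_mul_self (hs 0) (by rw [hz]; norm_num) (p := q / 2)
      (by linarith) (by linarith)
    rw [hpow] at this
    exact (sub_pos.2 this).ne' h
  have hpos := hc.integral_pos_of_hasCompactSupport_nonneg_nonzero (μ := haarPair)
    (HasCompactSupport.of_compactSpace D) hnonneg hne
  have i2 := integrable_of_continuous_pair hc2
  have i1 : Integrable (fun y => q / 2 * (‖pairFactor y‖ ^ 2 - 1)) haarPair :=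
    integrable_of_continuous_pair (by fun_prop)
  have i0 : Integrable (fun y => 1 + q / 2 * (‖pairFactor y‖ ^ 2 - 1)) haarPair :=
    integrable_of_continuous_pair (by fun_prop)
  simp only [hD] at hpos
  rw [integral_sub i0 (integrable_of_continuous_pair hcq), integral_add (integrable_const _) i1,
    integral_const_mul, integral_sub i2 (integrable_const _),
    integral_norm_pairFactor_sq] at hpos
  simpa using hpos

/-- Independence of the pairs turns the integral of the product into a power of one integral over
the two-dimensional torus. -/
theorem eLpNorm_block {q : ℝ≥0∞} (h0 : q ≠ 0) (ht : q ≠ ∞) (n : ℕ) :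
    eLpNorm (block (n + 1)) q haar = ENNReal.ofReal
      (((∫ y, ‖pairFactor y‖ ^ q.toReal ∂haarPair) ^ q.toReal⁻¹) ^ (n + 1)) := by
  have hI : 0 ≤ ∫ y, ‖pairFactor y‖ ^ q.toReal ∂haarPair :=
    integral_nonneg fun y => Real.rpow_nonneg (norm_nonneg _) _
  have hprod := integral_prod_pairs (blockIndices (n + 1)) (g := fun y => ‖pairFactor y‖ ^ q.toReal)
    (continuous_pairFactor.norm.rpow_const fun _ => Or.inr ENNReal.toReal_nonneg)
  rw [card_blockIndices] at hprod
  rw [(memLp_of_continuous (continuous_block (n + 1)) q).eLpNorm_eq_integral_rpow_norm h0 ht,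
    ← Real.rpow_mul_natCast hI, mul_comm q.toReal⁻¹, Real.rpow_mul hI, Real.rpow_natCast, ← hprod]
  congr 3
  funext x
  rw [Real.finsetProd_rpow _ _ (fun i _ => norm_nonneg _), ← norm_prod]
  rfl

/-! ### Duality: no preimage of the symbol in `L^p` -/

theorem inner_blockL2_toL2 {p : ℝ≥0∞} (hp : 2 ≤ p) (ψ : L p) (n : ℕ) :
    (inner ℂ (blockL2 n) (toL2 hp ψ) : ℂ) = ∫ x, conj (block n x) * ψ x ∂haar := by
  rw [L2.inner_def]
  refine integral_congr_ae ?_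
  filter_upwards [(memLp_of_continuous (continuous_block n) 2).coeFn_toLp,
    ((Lp.memLp ψ).mono_exponent hp).coeFn_toLp] with x hx hy
  rw [blockL2, toL2, hx, hy, RCLike.inner_apply, mul_comm]

theorem enorm_inner_toL2_le {p q : ℝ≥0∞} (hpq : q.HolderConjugate p) (hp : 2 ≤ p) (ψ : L p)
    (n : ℕ) :
    ‖(inner ℂ (blockL2 n) (toL2 hp ψ) : ℂ)‖ₑ ≤ eLpNorm (block n) q haar * eLpNorm ψ p haar := by
  rw [inner_blockL2_toL2]
  refine (enorm_integral_le_lintegral_enorm _).trans ?_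
  have h : ∀ x, ‖conj (block n x) * ψ x‖ₑ = ‖(block n • (ψ : UnitAddTorus ℕ → ℂ)) x‖ₑ := fun x => by
    rw [enorm_mul, RCLike.enorm_conj, ← enorm_mul]
    rfl
  simp only [h]
  rw [← eLpNorm_one_eq_lintegral_enorm]
  exact eLpNorm_smul_le_mul_eLpNorm (hpqr := hpq) (Lp.aestronglyMeasurable ψ)
    (continuous_block n).aestronglyMeasurable

theorem not_exists_P_eq_symbol {φ : hardy} (hφ : IsSymbol φ) {p : ℝ≥0∞} (hp : 2 < p) :
    ¬ ∃ ψ : L p, P (toL2 hp.le ψ) = φ := by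
  rintro ⟨ψ, hψ⟩
  have hφ' : HasSum (fun n => ((amplitude n : ℝ) : ℂ) • blockL2 (n + 1)) (φ : L 2) := hφ
  set q := p.conjExponent with hq
  have hqp : p.HolderConjugate q := .conjExponent (one_le_two.trans hp.le)
  have hqp' : q.HolderConjugate p := hqp.symm
  -- The conjugate exponent is `1 + (p - 1)⁻¹`, which also covers `p = ∞` with `q = 1`.
  have hq2 : q < 2 := by
    have h1 : 1 < p - 1 := by
      rw [lt_tsub_iff_right, one_add_one_eq_two]
      exact hp
    rw [hq, ENNReal.conjExponent, ← one_add_one_eq_two]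
    exact ENNReal.add_lt_add_left ENNReal.one_ne_top (ENNReal.inv_lt_one.2 h1)
  have hq0 : q ≠ 0 := by
    rw [hq, ENNReal.conjExponent]
    simp
  have hqt : q ≠ ∞ := ne_top_of_lt hq2
  have hq0' : 0 < q.toReal := ENNReal.toReal_pos hq0 hqt
  have hq2' : q.toReal < 2 := by
    simpa using (ENNReal.toReal_lt_toReal hqt ENNReal.ofNat_ne_top).2 hq2
  set I := ∫ y, ‖pairFactor y‖ ^ q.toReal ∂haarPair with hI
  have hI0 : 0 ≤ I := integral_nonneg fun y => Real.rpow_nonneg (norm_nonneg _) _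
  set θ := I ^ q.toReal⁻¹ with hθ
  have hθ0 : 0 ≤ θ := Real.rpow_nonneg hI0 _
  have hθ1 : θ < 1 := Real.rpow_lt_one hI0 (integral_norm_pairFactor_rpow_lt_one hq0' hq2')
    (inv_pos.2 hq0')
  set C := (eLpNorm ψ p haar).toReal with hC
  have hle : ∀ n, amplitude n ≤ θ ^ (n + 1) * C := by
    intro n
    -- Blocks lie in the Hardy space, so pairing with them does not distinguish `ψ` from its
    -- projection.
    have h1 : (inner ℂ (blockL2 (n + 1)) (toL2 hp.le ψ) : ℂ) = amplitude n := by
      rw [← inner_blockL2_symbol hφ' n, ← hψ, P]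
      exact (Submodule.inner_orthogonalProjectionOnto_eq_of_mem_left
        ⟨_, blockL2_mem_hardy n⟩ _).symm
    have h2 := enorm_inner_toL2_le hqp' hp.le ψ (n + 1)
    rw [h1, eLpNorm_block hq0 hqt, enorm_ofReal (amplitude_pos n).le,
      ← ENNReal.ofReal_toReal (Lp.eLpNorm_ne_top ψ), ← ENNReal.ofReal_mul (by positivity),
      ENNReal.ofReal_le_ofReal_iff (by positivity)] at h2
    exact h2
  -- Multiplied by `n + 1`, the bound `hle` puts the constant `√6 / π` below `(n + 1) θ ^ (n + 1)
  -- C`, which tends to zero.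
  have hlim := ((tendsto_self_mul_const_pow_of_lt_one hθ0 hθ1).comp
    (Filter.tendsto_add_atTop_nat 1)).mul_const C
  rw [zero_mul] at hlim
  have hge : Real.sqrt 6 / Real.pi ≤ 0 := by
    refine ge_of_tendsto' hlim fun n => ?_
    have h := hle n
    have hn : (0 : ℝ) < (n : ℝ) + 1 := by positivity
    rw [amplitude, mul_one_div, div_le_iff₀ hn] at h
    simp only [Function.comp_apply]
    push_cast
    linarith
  have : 0 < Real.sqrt 6 / Real.pi := by positivity
  linarith

end InfTorus

end

theorem theorem1p3 :
    ∃ φ : InfTorus.hardy, InfTorus.IsSymbol φ ∧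
      (∃ H : InfTorus.hardy →L[ℂ] InfTorus.conjHardy,
        InfTorus.IsHankelOperator φ H ∧ ‖H‖ = 1) ∧
      ‖φ‖ = 1 ∧
      ∀ (p : ℝ≥0∞) (hp : 2 < p),
        ¬ ∃ ψ : InfTorus.L p, InfTorus.P (InfTorus.toL2 hp.le ψ) = φ := by
  obtain ⟨φ, hnorm, hφ⟩ := InfTorus.exists_hasSum_symbol
  let φ' : InfTorus.hardy := ⟨φ, InfTorus.symbol_mem_hardy hφ⟩
  have hφ' : InfTorus.IsSymbol φ' := hφ
  exact ⟨φ', hφ', InfTorus.exists_hankelOperator hφ', hnorm,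
    fun p hp => InfTorus.not_exists_P_eq_symbol hφ' hp⟩
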